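/- Let $(*)$ denote the following dichotomy for p-ideals of countable sets. An ideal $\mathcal I$ of subsets of a set $S$ is a \emph{p-ideal} if for every sequence $\langle A_n:n\in\omega\rangle$ of members of $\mathcal I$ there is $A\in\mathcal I$ such that $A_n\setminus A$ is finite for every $n$. Then $(*)$ says: for every infinite set $S$ and every p-ideal $\mathcal I$ on $S$ all of whose members are countable, either (i) there is an uncountable $Y\subseteq S$ such that every countable subset of $Y$ belongs to $\mathcal I$, or (ii) there are sets $S_n$ $(n\in\omega)$ with $\bigcup_n S_n=S$ such that $S_n\cap I$ is finite for all $n\in\omega$ and $I\in\mathcal I$. In a Boolean algebra, an \emph{antichain} is a set of nonzero pairwise disjoint elements. A complete Boolean algebra $B$ is \emph{ccc} if every antichain in $B$ is countable, and \emph{weakly distributive} if for every sequence $\langle P_n:n\in\omega\rangle$ of countable maximal antichains there is a maximal antichain $Q$ such that each $q\in Q$ meets (has nonzero meet with) only finitely many elements of each $P_n$. A \emph{strictly positive Maharam submeasure} on $B$ is a function $\mu:B\to[0,\infty)$ such that $\mu(a)=0$ if and only if $a=\mathbf 0$; $\mu(a)\le\mu(b)$ whenever $a\le b$; $\mu(a\vee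 b)\le\mu(a)+\mu(b)$; and $\lim_n\mu(a_n)=0$ for every decreasing sequence $\langle a_n:n\in\omega\rangle$ with $\bigwedge_n a_n=\mathbf 0$. \textbf{Theorem.} Assume $(*)$. Then every weakly distributive ccc complete Boolean algebra carries a strictly positive Maharam submeasure. -/

import Mathlib

open Set Filter Topology

universe u

namespace BooleanSubmeasure

/-- An ideal of sets is a p-ideal if every sequence of its members is almost included in a single
member. -/
def IsPIdeal {S : Type u} (I : Order.Ideal (Set S)) : Prop :=
  ∀ A : ℕ → Set S, (∀ n, A n ∈ I) → ∃ C ∈ I, ∀ n, (A n \ C).Finite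

/-- The dichotomy (*) for p-ideals of countable sets: for every p-ideal `I` of countable subsets of
an infinite set `S`, either all countable subsets of some uncountable `Y` belong to `I`, or `S` is
the union of countably many sets each of which has finite intersection with every member of `I`. -/
def PIdealDichotomy : Prop :=
  ∀ (S : Type u) [Infinite S] (I : Order.Ideal (Set S)),
    (∀ A ∈ I, A.Countable) → IsPIdeal I →
      (∃ Y : Set S, ¬ Y.Countable ∧ ∀ A : Set S, A ⊆ Y → A.Countable → A ∈ I) ∨
      (∃ T : ℕ → Set S, (⋃ n, T n) = univ ∧ ∀ n, ∀ A ∈ I, (T n ∩ A).Finite)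

section Algebra

variable {B : Type u} [CompleteBooleanAlgebra B]

/-- An antichain in the sense of Boolean algebras: a set of nonzero pairwise disjoint elements. -/
def IsDisjointFamily (P : Set B) : Prop :=
  ⊥ ∉ P ∧ P.PairwiseDisjoint id

/-- A maximal antichain (maximal with respect to inclusion). -/
def IsMaximalDisjointFamily (P : Set B) : Prop :=
  Maximal IsDisjointFamily P

variable (B) in
/-- The countable chain condition: every antichain is countable. -/
def CCC : Prop :=
  ∀ P : Set B, IsDisjointFamily P → P.Countable

variable (B) in
/-- Weak distributivity: for every sequence of countable maximal antichains there is a maximal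
antichain `Q` each of whose elements meets only finitely many elements of each of them. -/
def WeaklyDistributive : Prop :=
  ∀ P : ℕ → Set B, (∀ n, (P n).Countable ∧ IsMaximalDisjointFamily (P n)) →
    ∃ Q : Set B, IsMaximalDisjointFamily Q ∧
      ∀ q ∈ Q, ∀ n, {p | p ∈ P n ∧ q ⊓ p ≠ ⊥}.Finite

/-- A submeasure: a nonnegative real-valued, monotone, subadditive function vanishing at `⊥`. -/
structure IsSubmeasure (μ : B → ℝ) : Prop where
  nonneg : ∀ a, 0 ≤ μ a
  bot : μ ⊥ = 0
  mono : ∀ a b, a ≤ b → μ a ≤ μ b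
  sup_le : ∀ a b, μ (a ⊔ b) ≤ μ a + μ b

/-- A Maharam submeasure: a submeasure which is continuous along decreasing sequences with
infimum `⊥`. -/
structure IsMaharamSubmeasure (μ : B → ℝ) : Prop extends IsSubmeasure μ where
  continuous : ∀ a : ℕ → B, Antitone a → (⨅ n, a n) = ⊥ →
    Tendsto (fun n => μ (a n)) atTop (𝓝 0)

/-- Strict positivity: only `⊥` has value `0`. -/
def IsStrictlyPositive (μ : B → ℝ) : Prop :=
  ∀ a, μ a = 0 → a = ⊥

end Algebra

end BooleanSubmeasure

namespace BooleanSubmeasure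

/-! The submeasure comes from metrizing, at `⊥`, the topology of algebraic convergence of sequences.
Neighbourhoods of `⊥` are lower sets that absorb every null sequence. Weak distributivity allows
null sequences to be diagonalized, so every neighbourhood contains an open one
(`IsNbhd.exists_isOpenNbhd`).

The dichotomy is applied to the p-ideal of countable null families. The ccc excludes its first
alternative (`CCC.countable_of_forall_mem_nullIdeal`), and the second gives countably many
neighbourhoods with intersection `{⊥}`. Weak distributivity improves this: each nonzero element
avoids all two-fold joins from some neighbourhood.

Joins of any fixed number of members of a small neighbourhood are two-fold joins from a given one
(`IsNbhd.exists_forall_sup_mem_twoFold`); the proof uses subsequences whose limsup no longer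
changes. Hence there are chains of neighbourhoods suitable for metrization. By the ccc, countably
many chains combine into one with intersection `{⊥}`. Frink's metrization of its dyadic gauge,
followed by a supremum over translates, yields the submeasure. -/

variable {B : Type u} [CompleteBooleanAlgebra B]

/-! ### Countable suprema and refinement of covers -/

/-- In a ccc algebra every supremum is the supremum of a countable subfamily. -/
theorem CCC.exists_countable_sSup_eq (hB : CCC B) (X : Set B) :
    ∃ C ⊆ X, C.Countable ∧ sSup C = sSup X := by
  -- A maximal antichain refining `X` is countable; one member of `X` above each of its elements
  -- suffices.
  obtain ⟨P, hP⟩ := zorn_subset {P : Set B | IsDisjointFamily P ∧ ∀ p ∈ P, ∃ x ∈ X, p ≤ x} (by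
    intro c hc hchain
    refine ⟨⋃₀ c, ⟨⟨?_, ?_⟩, ?_⟩, fun s hs => subset_sUnion_of_mem hs⟩
    · rintro ⟨s, hs, hbot⟩
      exact (hc hs).1.1 hbot
    · exact (pairwiseDisjoint_sUnion hchain.directedOn).2 fun s hs => (hc hs).1.2
    · rintro p ⟨s, hs, hp⟩
      exact (hc hs).2 p hp)
  have hcount := hB P hP.prop.1
  choose! g hgX hg using hP.prop.2
  refine ⟨g '' P, image_subset_iff.2 hgX, hcount.image g,
    le_antisymm (sSup_le_sSup (image_subset_iff.2 hgX)) (sSup_le fun x hx => ?_)⟩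
  by_contra hle
  have hne : x \ sSup (g '' P) ≠ ⊥ := fun h => hle (sdiff_eq_bot_iff.1 h)
  have hdisj : ∀ p ∈ P, Disjoint (x \ sSup (g '' P)) p := fun p hp =>
    disjoint_sdiff_self_left.mono_right ((hg p hp).trans (le_sSup (mem_image_of_mem g hp)))
  have hins : insert (x \ sSup (g '' P)) P ∈
      {P : Set B | IsDisjointFamily P ∧ ∀ p ∈ P, ∃ x ∈ X, p ≤ x} := by
    refine ⟨⟨?_, ?_⟩, ?_⟩
    · rintro (h | h)
      · exact hne h.symm
      · exact hP.prop.1.1 h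
    · exact hP.prop.1.2.insert fun p hp _ => hdisj p hp
    · rintro p (rfl | hp)
      · exact ⟨x, hx, sdiff_le⟩
      · exact hP.prop.2 p hp
  have hmem := hP.le_of_ge hins (subset_insert _ _) (mem_insert _ _)
  exact hne (disjoint_self.1 (hdisj _ hmem))

/-- In a ccc algebra every infimum is the infimum of a countable subfamily. -/
theorem CCC.exists_countable_sInf_eq (hB : CCC B) (X : Set B) :
    ∃ C ⊆ X, C.Countable ∧ sInf C = sInf X := by
  obtain ⟨C, hCX, hC, hsup⟩ := hB.exists_countable_sSup_eq (compl '' X)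
  refine ⟨compl '' C, ?_, hC.image _, ?_⟩
  · rintro _ ⟨c, hc, rfl⟩
    obtain ⟨x, hx, rfl⟩ := hCX hc
    simpa using hx
  · apply compl_injective
    rw [compl_sInf', compl_sInf', ← hsup, image_image]
    simp

theorem IsMaximalDisjointFamily.sSup_eq_top {P : Set B} (hP : IsMaximalDisjointFamily P) :
    sSup P = ⊤ := by
  by_contra hne
  have hne' : (sSup P)ᶜ ≠ ⊥ := fun h => hne (compl_eq_bot.1 h)
  have hdisj : ∀ p ∈ P, Disjoint (sSup P)ᶜ p := fun p hp =>
    disjoint_compl_left.mono_right (le_sSup hp)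
  have hins : IsDisjointFamily (insert (sSup P)ᶜ P) := by
    refine ⟨?_, hP.prop.2.insert fun p hp _ => hdisj p hp⟩
    rintro (h | h)
    · exact hne' h.symm
    · exact hP.prop.1 h
  have hmem := hP.le_of_ge hins (subset_insert _ _) (mem_insert _ _)
  exact hne' (disjoint_self.1 (hdisj _ hmem))

theorem IsDisjointFamily.isMaximal {P : Set B} (hP : IsDisjointFamily P) (htop : sSup P = ⊤) :
    IsMaximalDisjointFamily P := by
  refine ⟨hP, fun P' hP' hle p hp => ?_⟩
  by_contra hpP
  have : Disjoint p (sSup P) := disjoint_sSup_iff.2 fun a ha =>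
    hP'.2 hp (hle ha) (by rintro rfl; exact hpP ha)
  rw [htop, disjoint_top] at this
  exact hP'.1 (this ▸ hp)

/-- Weak distributivity for sequences of increasing covers. -/
theorem WeaklyDistributive.exists_refinement (hB : CCC B) (hwd : WeaklyDistributive B)
    (q : ℕ → ℕ → B) (hm : ∀ n, Monotone (q n)) (hq : ∀ n, ⨆ j, q n j = ⊤) :
    ∃ r : ℕ → B, ⨆ k, r k = ⊤ ∧ ∀ k n, ∃ j, r k ≤ q n j := by
  have hdis : ∀ n i j, i ≠ j → Disjoint (disjointed (q n) i) (disjointed (q n) j) :=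
    fun n i j hij => disjoint_disjointed (q n) hij
  obtain ⟨Q, hQ, hfin⟩ := hwd (fun n => range (disjointed (q n)) \ {⊥}) (fun n => by
    refine ⟨(countable_range _).mono sdiff_subset, IsDisjointFamily.isMaximal ⟨by simp, ?_⟩ ?_⟩
    · rintro _ ⟨⟨i, rfl⟩, -⟩ _ ⟨⟨j, rfl⟩, -⟩ hij
      exact hdis n i j fun h => hij (by rw [h])
    · rw [sSup_sdiff_singleton_bot, sSup_range, iSup_disjointed, hq n])
  have hbound : ∀ a ∈ insert ⊥ Q, ∀ n, ∃ j, a ≤ q n j := by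
    rintro a (rfl | ha) n
    · exact ⟨0, bot_le⟩
    have hfin' : {i | a ⊓ disjointed (q n) i ≠ ⊥}.Finite := by
      refine Finite.of_finite_image (f := disjointed (q n)) ((hfin a ha n).subset ?_) ?_
      · rintro _ ⟨i, hi, rfl⟩
        exact ⟨⟨mem_range_self i, fun h => hi (by rw [mem_singleton_iff.1 h, inf_bot_eq])⟩, hi⟩
      · intro i hi j _ hij
        by_contra hne
        have := hdis n i j hne
        rw [← hij, disjoint_self] at this
        exact hi (by rw [this, inf_bot_eq])
    obtain ⟨J, hJ⟩ := hfin'.bddAbove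
    refine ⟨J, ?_⟩
    have : a = ⨆ i, a ⊓ disjointed (q n) i := by
      rw [← inf_iSup_eq, iSup_disjointed, hq n, inf_top_eq]
    rw [this]
    refine iSup_le fun i => ?_
    by_cases hi : a ⊓ disjointed (q n) i = ⊥
    · rw [hi]; exact bot_le
    · exact inf_le_right.trans ((disjointed_le (q n) i).trans (hm n (hJ hi)))
  obtain ⟨r, hr⟩ := ((hB Q hQ.prop).insert ⊥).exists_eq_range (insert_nonempty _ _)
  refine ⟨r, ?_, fun k => hbound _ (hr ▸ mem_range_self k)⟩
  rw [← sSup_range, ← hr, sSup_insert, bot_sup_eq, hQ.sSup_eq_top]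

/-! ### Null sequences -/

/-- A sequence is null if it converges to `⊥` in the algebraic sense: some countable cover consists
of elements that are eventually disjoint from the sequence. -/
def IsNull (x : ℕ → B) : Prop :=
  ∃ r : ℕ → B, ⨆ k, r k = ⊤ ∧ ∀ k, ∀ᶠ n in atTop, Disjoint (r k) (x n)

theorem IsNull.mono {x y : ℕ → B} (hx : IsNull x) (h : ∀ n, y n ≤ x n) : IsNull y := by
  obtain ⟨r, hr, hd⟩ := hx
  exact ⟨r, hr, fun k => (hd k).mono fun n hn => hn.mono_right (h n)⟩

theorem IsNull.comp {x : ℕ → B} (hx : IsNull x) {φ : ℕ → ℕ} (hφ : Tendsto φ atTop atTop) :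
    IsNull (x ∘ φ) := by
  obtain ⟨r, hr, hd⟩ := hx
  exact ⟨r, hr, fun k => hφ.eventually (hd k)⟩

theorem isNull_bot : IsNull (fun _ => ⊥ : ℕ → B) :=
  ⟨fun _ => ⊤, by simp, by simp⟩

theorem IsNull.exists_monotone {x : ℕ → B} (hx : IsNull x) :
    ∃ q : ℕ → B, Monotone q ∧ ⨆ k, q k = ⊤ ∧ ∀ k, ∀ᶠ n in atTop, Disjoint (q k) (x n) := by
  obtain ⟨r, hr, hd⟩ := hx
  refine ⟨partialSups r, (partialSups r).monotone, by rw [iSup_partialSups_eq, hr], fun k => ?_⟩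
  have := (finite_Iic k).eventually_all.2 fun i _ => hd i
  filter_upwards [this] with n hn
  rw [← le_compl_iff_disjoint_right]
  exact partialSups_le _ _ _ fun i hi => (hn i hi).le_compl_right

theorem IsNull.sup {x y : ℕ → B} (hx : IsNull x) (hy : IsNull y) :
    IsNull (fun n => x n ⊔ y n) := by
  obtain ⟨p, hp, hp', hpd⟩ := hx.exists_monotone
  obtain ⟨q, hq, hq', hqd⟩ := hy.exists_monotone
  refine ⟨fun k => p k ⊓ q k, ?_, fun k => ?_⟩
  · rw [iSup_inf_of_monotone hp hq, hp', hq', inf_top_eq]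
  · filter_upwards [hpd k, hqd k] with n h1 h2
    exact disjoint_sup_right.2 ⟨h1.mono_left inf_le_left, h2.mono_left inf_le_right⟩

theorem IsNull.finset_sup {ι : Type*} (s : Finset ι) {x : ι → ℕ → B} (hx : ∀ i, IsNull (x i)) :
    IsNull (fun n => s.sup fun i => x i n) := by
  classical
  induction s using Finset.induction_on with
  | empty => simpa using isNull_bot
  | insert i s _ ih => simpa [Finset.sup_insert] using (hx i).sup ih

theorem isNull_of_antitone {a : ℕ → B} (ha : Antitone a) (hinf : ⨅ n, a n = ⊥) : IsNull a :=
  ⟨fun k => (a k)ᶜ, by rw [← compl_iInf, hinf, compl_bot], fun k =>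
    (eventually_ge_atTop k).mono fun _ hn => disjoint_compl_left.mono_right (ha hn)⟩

/-- Weak distributivity allows null sequences to be diagonalized. -/
theorem exists_diagonal_isNull (hB : CCC B) (hwd : WeaklyDistributive B) {y : ℕ → ℕ → B}
    (hy : ∀ n, IsNull (y n)) : ∃ j : ℕ → ℕ, IsNull (fun n => y n (j n)) := by
  choose q hqm hq hqd using fun n => (hy n).exists_monotone
  obtain ⟨r, hr, hrq⟩ := hwd.exists_refinement hB q hqm hq
  choose J hJ using hrq
  have : ∀ n, ∃ j, ∀ k ∈ Iic n, Disjoint (r k) (y n j) := fun n =>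
    ((finite_Iic n).eventually_all.2 fun k _ =>
      (hqd n (J k n)).mono fun j hj => hj.mono_left (hJ k n)).exists
  choose j hj using this
  exact ⟨j, r, hr, fun k => (eventually_ge_atTop k).mono fun n hn => hj n k hn⟩

/-! ### Neighbourhoods of `⊥` -/

/-- Lower sets absorbing all null sequences. -/
structure IsNbhd (U : Set B) : Prop where
  lower : IsLowerSet U
  absorbs : ∀ x : ℕ → B, IsNull x → ∀ᶠ n in atTop, x n ∈ U

theorem exists_isNull_forall_notMem {V : Set B}
    (hV : ¬ ∀ x : ℕ → B, IsNull x → ∀ᶠ n in atTop, x n ∈ V) :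
    ∃ x : ℕ → B, IsNull x ∧ ∀ n, x n ∉ V := by
  push Not at hV
  obtain ⟨x, hx, hxV⟩ := hV
  obtain ⟨φ, hφ, hφV⟩ := extraction_of_frequently_atTop hxV
  exact ⟨x ∘ φ, hx.comp hφ.tendsto_atTop, hφV⟩

theorem IsNbhd.bot_mem {U : Set B} (hU : IsNbhd U) : ⊥ ∈ U :=
  (hU.absorbs _ isNull_bot).exists.choose_spec

theorem isNbhd_univ : IsNbhd (univ : Set B) := ⟨isLowerSet_univ, by simp⟩

theorem IsNbhd.biInter {ι : Type*} {s : Set ι} (hs : s.Finite) {U : ι → Set B}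
    (hU : ∀ i ∈ s, IsNbhd (U i)) : IsNbhd (⋂ i ∈ s, U i) where
  lower := isLowerSet_iInter₂ fun i hi => (hU i hi).lower
  absorbs x hx := by
    simpa using hs.eventually_all.2 fun i hi => (hU i hi).absorbs x hx

theorem IsNbhd.inter {U V : Set B} (hU : IsNbhd U) (hV : IsNbhd V) : IsNbhd (U ∩ V) :=
  ⟨hU.lower.inter hV.lower, fun x hx => (hU.absorbs x hx).and (hV.absorbs x hx)⟩

/-- The largest lower set inside a set that absorbs all null sequences. -/
theorem isNbhd_lowerCore {U : Set B} (hU : ∀ x : ℕ → B, IsNull x → ∀ᶠ n in atTop, x n ∈ U) :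
    IsNbhd {a | ∀ b ≤ a, b ∈ U} where
  lower a b hba ha c hc := ha c (hc.trans hba)
  absorbs := by
    by_contra h
    obtain ⟨x, hx, hxU⟩ := exists_isNull_forall_notMem h
    simp only [mem_ofPred_eq, not_forall] at hxU
    choose y hyx hyU using hxU
    obtain ⟨n, hn⟩ := (hU y (hx.mono hyx)).exists
    exact hyU n hn

/-- Neighbourhoods that are neighbourhoods of all their points. -/
def IsOpenNbhd (U : Set B) : Prop :=
  IsNbhd U ∧ ∀ a ∈ U, IsNbhd {v | a ⊔ v ∈ U}

/-- `V` is the interior of `U`. If `a` is interior but `a ⊔ x n` is not, for a null `x`, then null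
sequences `y n` witness this. A diagonal `x n ⊔ y n (j n)` is null, yet never absorbed by `{v | a ⊔
v ∈ U}`. -/
theorem IsNbhd.exists_isOpenNbhd (hB : CCC B) (hwd : WeaklyDistributive B) {U : Set B}
    (hU : IsNbhd U) : ∃ V ⊆ U, IsOpenNbhd V := by
  have hlow : ∀ a, IsLowerSet {v | a ⊔ v ∈ U} := fun a v w hwv hv =>
    hU.lower (sup_le_sup_left hwv a) hv
  have key : ∀ a, IsNbhd {v | a ⊔ v ∈ U} → IsNbhd {v | IsNbhd {w | (a ⊔ v) ⊔ w ∈ U}} := by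
    intro a ha
    refine ⟨fun v w hwv hv => ⟨hlow _, fun x hx => ?_⟩, ?_⟩
    · filter_upwards [hv.absorbs x hx] with n hn
      exact hU.lower (sup_le_sup_right (sup_le_sup_left hwv a) _) hn
    · by_contra h
      obtain ⟨x, hx, hxV⟩ := exists_isNull_forall_notMem h
      have : ∀ n, ∃ y : ℕ → B, IsNull y ∧ ∀ j, y j ∉ {w | (a ⊔ x n) ⊔ w ∈ U} := fun n =>
        exists_isNull_forall_notMem fun h => hxV n ⟨hlow _, h⟩
      choose y hy hyU using this
      obtain ⟨j, hj⟩ := exists_diagonal_isNull hB hwd hy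
      obtain ⟨n, hn⟩ := (ha.absorbs _ (hx.sup hj)).exists
      refine hyU n (j n) ?_
      rwa [mem_ofPred_eq, sup_assoc]
  refine ⟨{a | IsNbhd {v | a ⊔ v ∈ U}}, fun a ha => by simpa using ha.bot_mem, ?_,
    fun a ha => key a ha⟩
  simpa using key ⊥ (by simpa using hU)

/-! ### Stable subsequences -/

/-- In a ccc algebra, a monotone function on a preorder in which countable chains have lower bounds
is constant below some point. -/
theorem CCC.exists_forall_le_eq (hB : CCC B) {α : Type*} [Preorder α] [Nonempty α]
    (hα : ∀ s : Set α, s.Countable → s.Nonempty → IsChain (· ≤ ·) s → ∃ a, ∀ b ∈ s, a ≤ b)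
    {L : α → B} (hL : Monotone L) : ∃ a, ∀ b ≤ a, L b = L a := by
  by_contra! hcon
  -- The values of `L` on a maximal strictly decreasing chain have the infimum of countably many of
  -- them. A lower bound of the corresponding countable subchain would extend the chain.
  obtain ⟨M, hM, -⟩ := (IsChain.empty (r := fun a b : α => a ≤ b ∧ L a < L b)).exists_maxChain
  have hnot : ∀ a, ¬ ∀ b ∈ M, a ≤ b ∧ L a < L b := by
    intro a ha
    have hchain := hM.1.insert (a := a) fun b hb _ => Or.inl (ha b hb)
    have : a ∈ M := hM.2 hchain (subset_insert _ _) ▸ mem_insert a M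
    exact (ha a this).2.false
  have hstep : ∀ a, ∃ b ≤ a, L b < L a := fun a => by
    obtain ⟨b, hb, hne⟩ := hcon a
    exact ⟨b, hb, (hL hb).lt_of_ne hne⟩
  have hMne : M.Nonempty := by
    by_contra h
    rw [not_nonempty_iff_eq_empty] at h
    exact hnot (Classical.arbitrary α) (by simp [h])
  have hnomin : ∀ a ∈ M, ∃ b ∈ M, L b < L a := by
    intro a ha
    by_contra! h
    obtain ⟨c, hca, hc⟩ := hstep a
    refine hnot c fun b hb => ?_
    by_cases hba : a = b
    · exact hba ▸ ⟨hca, hc⟩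
    · rcases hM.1 ha hb hba with h' | h'
      · exact ⟨hca.trans h'.1, hc.trans h'.2⟩
      · exact absurd h'.2 (h b hb)
  obtain ⟨C, hCM, hC, hinf⟩ := hB.exists_countable_sInf_eq (L '' M)
  obtain ⟨D, hDM, hD, rfl⟩ : ∃ D ⊆ M, D.Countable ∧ C = L '' D := by
    have hCM' : ∀ c ∈ C, ∃ a ∈ M, L a = c := fun c hc => hCM hc
    choose! g hg hgC using hCM'
    refine ⟨g '' C, image_subset_iff.2 hg, hC.image g, ?_⟩
    rw [image_image]
    ext c
    refine ⟨fun hc => ⟨c, hc, hgC c hc⟩, ?_⟩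
    rintro ⟨d, hd, rfl⟩
    simpa only [hgC d hd] using hd
  have hbelow : ∀ a ∈ M, ∃ d ∈ D, d ≤ a ∧ L d < L a := by
    intro a ha
    obtain ⟨b, hb, hba⟩ := hnomin a ha
    have : ¬ L a ≤ sInf (L '' D) := fun h =>
      (h.trans (hinf.le.trans (sInf_le (mem_image_of_mem L hb)))).not_gt hba
    simp only [le_sInf_iff, forall_mem_image, not_forall] at this
    obtain ⟨d, hd, hda⟩ := this
    refine ⟨d, hd, ?_⟩
    rcases hM.1 (hDM hd) ha (by rintro rfl; exact hda le_rfl) with h' | h'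
    · exact h'
    · exact absurd h'.2.le hda
  have hDne : D.Nonempty := by
    obtain ⟨a, ha⟩ := hMne
    obtain ⟨d, hd, -⟩ := hbelow a ha
    exact ⟨d, hd⟩
  obtain ⟨a, ha⟩ := hα D hD hDne fun x hx y hy hxy =>
    (hM.1 (hDM hx) (hDM hy) hxy).imp And.left And.left
  refine hnot a fun b hb => ?_
  obtain ⟨d, hd, hdb, hlt⟩ := hbelow b hb
  exact ⟨(ha d hd).trans hdb, (hL (ha d hd)).trans_lt hlt⟩

/-- A sequence is stable if it is contained, up to a null sequence, in the supremum of each of its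
subsequences. -/
def IsStable (x : ℕ → B) : Prop :=
  ∀ ψ : ℕ → ℕ, StrictMono ψ → IsNull (fun n => x n \ ⨆ m, x (ψ m))

theorem IsStable.comp {x : ℕ → B} (hx : IsStable x) {φ : ℕ → ℕ} (hφ : StrictMono φ) :
    IsStable (x ∘ φ) := fun ψ hψ => (hx (φ ∘ ψ) (hφ.comp hψ)).comp hφ.tendsto_atTop

theorem isNull_sdiff_limsup (x : ℕ → B) : IsNull (fun n => x n \ limsup x atTop) := by
  refine ⟨fun k => limsup x atTop ⊔ (⨆ i ≥ k, x i)ᶜ, ?_, fun k => ?_⟩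
  · rw [← sup_iSup, ← compl_iInf, ← limsup_eq_iInf_iSup_of_nat, sup_compl_eq_top]
  · filter_upwards [eventually_ge_atTop k] with n hn
    refine disjoint_sup_left.2 ⟨disjoint_sdiff_self_right, ?_⟩
    exact disjoint_compl_left.mono_right (sdiff_le.trans (le_iSup₂_of_le n hn le_rfl))

/-- Along some subsequence the limsup is the same for all further subsequences. It then lies below
the supremum of each of them, while the terms lie below it up to a null sequence. -/
theorem CCC.exists_isStable_comp (hB : CCC B) (x : ℕ → B) :
    ∃ φ : ℕ → ℕ, StrictMono φ ∧ IsStable (x ∘ φ) := by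
  -- Filters replace subsequences because a countable chain of them has an infimum of the same kind.
  let α := {F : Filter ℕ // F.NeBot ∧ F.IsCountablyGenerated ∧ F ≤ atTop}
  have : Nonempty α := ⟨⟨atTop, inferInstance, inferInstance, le_rfl⟩⟩
  obtain ⟨⟨F, hF, hFc, hFtop⟩, hst⟩ := hB.exists_forall_le_eq (α := α)
    (L := fun F => limsup x F.1) (by
      intro s hs hne hchain
      have := hs.to_subtype
      have := hne.to_subtype
      have hdir : Directed (· ≥ ·) fun F : s => F.1.1 := by
        intro F G
        rcases hchain.total F.2 G.2 with h | h
        · exact ⟨F, le_rfl, h⟩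
        · exact ⟨G, h, le_rfl⟩
      refine ⟨⟨⨅ F : s, F.1.1, ?_, ?_, ?_⟩, fun G hG => iInf_le (fun F : s => F.1.1) ⟨G, hG⟩⟩
      · have : ∀ F : s, F.1.1.NeBot := fun F => F.1.2.1
        exact iInf_neBot_of_directed' hdir this
      · have : ∀ F : s, F.1.1.IsCountablyGenerated := fun F => F.1.2.2.1
        exact Filter.iInf.isCountablyGenerated _
      · obtain ⟨G, hG⟩ := hne
        exact (iInf_le (fun F : s => F.1.1) ⟨G, hG⟩).trans G.2.2.2)
    (fun F G hFG => limsup_le_limsup_of_le hFG)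
  obtain ⟨φ, hφ⟩ := exists_seq_tendsto F
  obtain ⟨θ, hθ, hφθ⟩ := strictMono_subseq_of_tendsto_atTop (hφ.mono_right hFtop)
  have hlim : ∀ ψ : ℕ → ℕ, StrictMono ψ → limsup (x ∘ ((φ ∘ θ) ∘ ψ)) atTop = limsup x F := by
    intro ψ hψ
    have hle : map ((φ ∘ θ) ∘ ψ) atTop ≤ F :=
      hφ.comp (hθ.tendsto_atTop.comp hψ.tendsto_atTop)
    exact hst ⟨map ((φ ∘ θ) ∘ ψ) atTop, inferInstance, inferInstance, hle.trans hFtop⟩ hle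
  refine ⟨φ ∘ θ, hφθ, fun ψ hψ => (isNull_sdiff_limsup (x ∘ (φ ∘ θ))).mono fun n => ?_⟩
  refine sdiff_le_sdiff_left ?_
  rw [show limsup (x ∘ (φ ∘ θ)) atTop = limsup x F from hlim id strictMono_id, ← hlim ψ hψ]
  exact limsup_le_of_le (by isBoundedDefault)
    (Eventually.of_forall fun m => le_iSup (fun m => (x ∘ (φ ∘ θ)) (ψ m)) m)

theorem CCC.exists_forall_isStable_comp (hB : CCC B) {ι : Type*} (s : Finset ι)
    (x : ι → ℕ → B) : ∃ φ : ℕ → ℕ, StrictMono φ ∧ ∀ i ∈ s, IsStable (x i ∘ φ) := by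
  classical
  induction s using Finset.induction_on with
  | empty => exact ⟨id, strictMono_id, by simp⟩
  | insert i s _ ih =>
    obtain ⟨φ, hφ, hs⟩ := ih
    obtain ⟨θ, hθ, hst⟩ := hB.exists_isStable_comp (x i ∘ φ)
    refine ⟨φ ∘ θ, hφ.comp hθ, fun j hj => ?_⟩
    rcases Finset.mem_insert.1 hj with rfl | hj
    · exact hst
    · exact (hs j hj).comp hθ

/-! ### Reducing finite joins to two-fold joins -/

/-- The elements covered by two members of `U`. -/
def twoFold (U : Set B) : Set B :=
  {w | ∃ u ∈ U, ∃ v ∈ U, w ≤ u ⊔ v}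

theorem isNbhd_twoFold {U : Set B} (hU : IsNbhd U) : IsNbhd (twoFold U) where
  lower := by
    rintro a b hba ⟨u, hu, v, hv, h⟩
    exact ⟨u, hu, v, hv, hba.trans h⟩
  absorbs x hx := by
    filter_upwards [hU.absorbs x hx] with n hn
    exact ⟨x n, hn, x n, hn, le_sup_left⟩

/-- Every sequence of choices from a suitable sequence of tuples has its finite joins in `U`. -/
theorem exists_forall_finset_sup_mem (hB : CCC B) (hwd : WeaklyDistributive B) {ι : Type*}
    [Finite ι] {U : Set B} (hU : IsNbhd U) {p : (ι → B) → Prop}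
    (hp : ∀ V, IsNbhd V → ∃ f : ι → B, (∀ i, f i ∈ V) ∧ p f) :
    ∃ f : ℕ → ι → B, (∀ n, p (f n)) ∧
      ∀ (σ : ℕ → ι) (s : Finset ℕ), s.sup (fun n => f n (σ n)) ∈ U := by
  obtain ⟨U', hU'U, hU'⟩ := hU.exists_isOpenNbhd hB hwd
  have hstep : ∀ V : {V : Set B // IsOpenNbhd V}, ∃ W : {V : Set B // IsOpenNbhd V}, ∃ f : ι → B,
      p f ∧ W.1 ⊆ V.1 ∧ ∀ i, ∀ w ∈ W.1, f i ⊔ w ∈ V.1 := by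
    rintro ⟨V, hV⟩
    obtain ⟨f, hf, hpf⟩ := hp V hV.1
    have hN : IsNbhd (V ∩ ⋂ i ∈ (univ : Set ι), {w | f i ⊔ w ∈ V}) :=
      hV.1.inter (IsNbhd.biInter finite_univ fun i _ => hV.2 _ (hf i))
    obtain ⟨W, hWsub, hW⟩ := hN.exists_isOpenNbhd hB hwd
    refine ⟨⟨W, hW⟩, f, hpf, fun w hw => (hWsub hw).1, fun i w hw => ?_⟩
    have := (hWsub hw).2
    simp only [mem_iInter] at this
    exact this i (mem_univ i)
  choose next f hpf hsub hf using hstep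
  let V : ℕ → {V : Set B // IsOpenNbhd V} := fun n => next^[n] ⟨U', hU'⟩
  have hV : ∀ n, V (n + 1) = next (V n) := fun n => Function.iterate_succ_apply' _ _ _
  refine ⟨fun n => f (V n), fun n => hpf _, fun σ s => ?_⟩
  -- Joins accumulate from the last index down: `f (V m) i` joined with a member of `V (m + 1)`
  -- stays in `V m`.
  have hrange : ∀ n m, (Finset.Ico m (m + n)).sup (fun k => f (V k) (σ k)) ∈ (V m).1 := by
    intro n
    induction n with
    | zero => intro m; simpa using (V m).2.1.bot_mem
    | succ n ih =>
      intro m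
      rw [← Finset.insert_Ico_add_one_left_eq_Ico (by omega), Finset.sup_insert]
      refine hf (V m) (σ m) _ ?_
      rw [← hV]
      rw [show m + (n + 1) = m + 1 + n by omega]
      exact ih (m + 1)
  obtain ⟨N, hN⟩ := s.exists_nat_subset_range
  refine hU.lower (Finset.sup_mono hN) (hU'U ?_)
  have := hrange N 0
  rwa [zero_add, Nat.Ico_zero_eq_range] at this

/-- For every neighbourhood `U` and every `N` there is a neighbourhood `V` all of whose `N`-fold joins
lie below joins of two members of `U`. -/
theorem IsNbhd.exists_forall_sup_mem_twoFold (hB : CCC B) (hwd : WeaklyDistributive B) {U : Set B}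
    (hU : IsNbhd U) (N : ℕ) [NeZero N] : ∃ V, IsNbhd V ∧
      ∀ f : Fin N → B, (∀ i, f i ∈ V) → Finset.univ.sup f ∈ twoFold U := by
  by_contra! hcon
  obtain ⟨f, hfU, hf⟩ := exists_forall_finset_sup_mem hB hwd hU hcon
  obtain ⟨φ, hφ, hst⟩ := hB.exists_forall_isStable_comp Finset.univ (fun i n => f n i)
  let ψ : Fin N → ℕ → ℕ := fun i m => N * m + i
  have hψ : ∀ i, StrictMono (ψ i) := fun i a b hab =>
    Nat.add_lt_add_right (Nat.mul_lt_mul_of_pos_left hab (NeZero.pos N)) _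
  -- Interleaving the coordinates modulo `N` makes the single supremum of `t` contain a subsequence
  -- of every coordinate. By stability it covers all coordinates up to a null error, and its finite
  -- parts `P n` lie in `U`.
  let t : ℕ → B := fun k => f (φ k) (Fin.ofNat N k)
  have ht : ∀ i m, f (φ (ψ i m)) i ≤ ⨆ k, t k := by
    intro i m
    have : t (ψ i m) = f (φ (ψ i m)) i := by
      have : Fin.ofNat N (ψ i m) = i := by
        ext
        simp [ψ, Fin.ofNat, Nat.mod_eq_of_lt i.2]
      simp only [t, this]
    exact this ▸ le_iSup t _
  let P : ℕ → B := fun n => (Finset.range n).sup t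
  have hPmono : Monotone P := fun a b hab => Finset.sup_mono (Finset.range_mono hab)
  have hPt : (⨆ k, t k) ≤ ⨆ n, P n := iSup_le fun k =>
    le_iSup_of_le (k + 1) (Finset.le_sup (f := t) (Finset.self_mem_range_succ k))
  have hPU : ∀ n, P n ∈ U := by
    intro n
    -- The inverse of `φ` recovers `k` from `φ k`; values outside the range of `φ` play no role.
    have := hf (fun j => Fin.ofNat N (Function.invFun φ j)) ((Finset.range n).image φ)
    rw [Finset.sup_image] at this
    convert this using 2
    ext k
    simp [t, Function.leftInverse_invFun hφ.injective k]
  have hrest : IsNull fun n => (⨆ k, t k) \ P n := by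
    refine isNull_of_antitone (fun a b hab => sdiff_le_sdiff_left (hPmono hab)) ?_
    simp only [_root_.sdiff_eq]
    rw [← inf_iInf, ← compl_iSup, ← _root_.sdiff_eq]
    exact sdiff_eq_bot_iff.2 hPt
  have herr : IsNull fun n => Finset.univ.sup fun i => f (φ n) i \ ⨆ m, f (φ (ψ i m)) i :=
    IsNull.finset_sup _ fun i => hst i (Finset.mem_univ i) (ψ i) (hψ i)
  obtain ⟨n, hn⟩ := (hU.absorbs _ (hrest.sup herr)).exists
  refine hfU (φ n) ⟨P n, hPU n, _, hn, Finset.sup_le fun i _ => ?_⟩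
  rw [← sup_assoc, sup_sdiff_self_right]
  calc f (φ n) i ≤ (⨆ m, f (φ (ψ i m)) i) ⊔ f (φ n) i \ ⨆ m, f (φ (ψ i m)) i :=
        le_sup_sdiff
    _ ≤ _ := sup_le_sup ((iSup_le fun m => ht i m).trans le_sup_right)
        (Finset.le_sup (f := fun i => f (φ n) i \ ⨆ m, f (φ (ψ i m)) i) (Finset.mem_univ i))

/-! ### The p-ideal of null families and the dichotomy -/

/-- The ideal of countable subsets of `B × ℕ` whose first coordinates form a null family. -/
def nullIdeal (B : Type u) [CompleteBooleanAlgebra B] : Order.Ideal (Set (B × ℕ)) where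
  carrier := {A | A.Countable ∧ ∃ q : ℕ → B, Monotone q ∧ ⨆ k, q k = ⊤ ∧
    ∀ k, {p ∈ A | ¬ Disjoint (q k) p.1}.Finite}
  lower' := by
    rintro A A' hA'A ⟨hA, q, hqm, hq, hfin⟩
    exact ⟨hA.mono hA'A, q, hqm, hq, fun k => (hfin k).subset fun p hp => ⟨hA'A hp.1, hp.2⟩⟩
  nonempty' := ⟨∅, countable_empty, fun _ => ⊤, monotone_const, by simp, by simp⟩
  directed' := by
    rintro A ⟨hA, q, hqm, hq, hfin⟩ A' ⟨hA', q', hqm', hq', hfin'⟩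
    refine ⟨A ∪ A', ⟨hA.union hA', fun k => q k ⊓ q' k, hqm.inf hqm', ?_, fun k => ?_⟩,
      subset_union_left, subset_union_right⟩
    · rw [iSup_inf_of_monotone hqm hqm', hq, hq', inf_top_eq]
    · refine ((hfin k).union (hfin' k)).subset ?_
      rintro p ⟨hp | hp, hd⟩
      · exact Or.inl ⟨hp, fun h => hd (h.mono_left inf_le_left)⟩
      · exact Or.inr ⟨hp, fun h => hd (h.mono_left inf_le_right)⟩

theorem mem_nullIdeal {A : Set (B × ℕ)} : A ∈ nullIdeal B ↔ A.Countable ∧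
    ∃ q : ℕ → B, Monotone q ∧ ⨆ k, q k = ⊤ ∧ ∀ k, {p ∈ A | ¬ Disjoint (q k) p.1}.Finite :=
  Iff.rfl

/-- A common refinement `r` of the covers works for all `A n` at once. Dropping from `A n` the
finitely many members that meet `r 0, …, r n` makes the union a null family. -/
theorem isPIdeal_nullIdeal (hB : CCC B) (hwd : WeaklyDistributive B) :
    IsPIdeal (nullIdeal B) := by
  intro A hA
  choose hAc q hqm hq hfin using fun n => mem_nullIdeal.1 (hA n)
  obtain ⟨r, hr, hrq⟩ := hwd.exists_refinement hB q hqm hq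
  have hfinr : ∀ k n, {p ∈ A n | ¬ Disjoint (r k) p.1}.Finite := by
    intro k n
    obtain ⟨j, hj⟩ := hrq k n
    exact (hfin n j).subset fun p hp => ⟨hp.1, fun h => hp.2 (h.mono_left hj)⟩
  have hfinp : ∀ k n, {p ∈ A n | ¬ Disjoint (partialSups r k) p.1}.Finite := by
    intro k n
    refine ((finite_Iic k).biUnion fun i _ => hfinr i n).subset ?_
    rintro p ⟨hp, hd⟩
    by_contra h
    simp only [mem_iUnion, not_exists] at h
    refine hd (le_compl_iff_disjoint_right.1 (partialSups_le _ _ _ fun i hi => ?_))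
    by_contra hi'
    exact h i hi ⟨hp, fun hd' => hi' hd'.le_compl_right⟩
  refine ⟨⋃ n, {p ∈ A n | Disjoint (partialSups r n) p.1}, mem_nullIdeal.2
    ⟨countable_iUnion fun n => (hAc n).mono (sep_subset _ _), partialSups r,
      (partialSups r).monotone, by rw [iSup_partialSups_eq, hr], fun k => ?_⟩, fun n => ?_⟩
  · refine ((finite_Iio k).biUnion fun i _ => hfinp k i).subset ?_
    rintro p ⟨hp, hd⟩
    obtain ⟨n, hpn, hdn⟩ := mem_iUnion.1 hp
    have hnk : n < k := by
      by_contra! hkn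
      exact hd (hdn.mono_left ((partialSups r).monotone hkn))
    exact mem_biUnion (x := n) hnk ⟨hpn, hd⟩
  · refine (hfinp n n).subset fun p hp => ⟨hp.1, fun hd => hp.2 ?_⟩
    exact mem_iUnion.2 ⟨n, hp.1, hd⟩

/-- In a ccc algebra, no uncountable set has all its countable subsets in the null ideal. -/
theorem CCC.countable_of_forall_mem_nullIdeal (hB : CCC B) {Y : Set (B × ℕ)}
    (hY : ∀ A ⊆ Y, A.Countable → A ∈ nullIdeal B) : Y.Countable := by
  by_contra hYc
  -- By the ccc, `Z` contains its supremum. Its complement `t` is nonzero, and everything that meets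
  -- `t` meets uncountably many members of `Y`.
  let Z : Set B := {b | {p ∈ Y | ¬ Disjoint b p.1}.Countable}
  obtain ⟨C, hCZ, hC, hCsup⟩ := hB.exists_countable_sSup_eq Z
  have hz : {p ∈ Y | ¬ Disjoint (sSup Z) p.1}.Countable := by
    refine (hC.biUnion fun c hc => hCZ hc).mono ?_
    rintro p ⟨hp, hd⟩
    rw [← hCsup, sSup_disjoint_iff] at hd
    push Not at hd
    obtain ⟨c, hc, hcp⟩ := hd
    exact mem_biUnion hc ⟨hp, hcp⟩
  set t := (sSup Z)ᶜ with ht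
  have htne : t ≠ ⊥ := by
    intro h
    rw [ht, compl_eq_bot] at h
    rw [h] at hz
    refine hYc ((hz.union (countable_range fun n : ℕ => ((⊥ : B), n))).mono fun p hp => ?_)
    by_cases hp1 : p.1 = ⊥
    · exact Or.inr ⟨p.2, by rw [← hp1]⟩
    · exact Or.inl ⟨hp, by simpa using hp1⟩
  -- Countably many members of `Y \ E` have the same supremum as all of them, so they catch every
  -- `b` meeting `t`. Iterating gives a countable subset of `Y` that any such `b` meets infinitely
  -- often, so it is not a null family.
  have hstep : ∀ E : {E : Set (B × ℕ) // E ⊆ Y ∧ E.Countable},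
      ∃ F : {E : Set (B × ℕ) // E ⊆ Y ∧ E.Countable}, E.1 ⊆ F.1 ∧
        ∀ b, ¬ Disjoint b t → ∃ p ∈ F.1 \ E.1, ¬ Disjoint b p.1 := by
    rintro ⟨E, hEY, hE⟩
    obtain ⟨D, hDsub, hD, hDsup⟩ := hB.exists_countable_sSup_eq (Prod.fst '' (Y \ E))
    choose! g hg hgD using fun d (hd : d ∈ D) => hDsub hd
    refine ⟨⟨E ∪ g '' D, union_subset hEY (image_subset_iff.2 fun d hd => (hg d hd).1),
      hE.union (hD.image g)⟩, subset_union_left, fun b hb => ?_⟩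
    by_contra! hcon
    have hbD : Disjoint b (sSup D) := disjoint_sSup_iff.2 fun d hd => by
      have := hcon (g d) ⟨Or.inr (mem_image_of_mem g hd), (hg d hd).2⟩
      rwa [hgD d hd] at this
    rw [hDsup, disjoint_sSup_iff] at hbD
    have hbZ : b ∈ Z := hE.mono fun p hp => by
      by_contra hpE
      exact hp.2 (hbD p.1 (mem_image_of_mem _ ⟨hp.1, hpE⟩))
    exact hb (disjoint_compl_right.mono_left (le_sSup hbZ))
  choose next hsub hnext using hstep
  let E : ℕ → {E : Set (B × ℕ) // E ⊆ Y ∧ E.Countable} := fun n =>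
    next^[n] ⟨∅, empty_subset _, countable_empty⟩
  have hE : ∀ n, E (n + 1) = next (E n) := fun n => Function.iterate_succ_apply' _ _ _
  have hmono : Monotone fun n => (E n).1 := monotone_nat_of_le_succ fun n => by
    rw [hE]; exact hsub _
  obtain ⟨-, q, -, hq, hfin⟩ := mem_nullIdeal.1
    (hY (⋃ n, (E n).1) (iUnion_subset fun n => (E n).2.1) (countable_iUnion fun n => (E n).2.2))
  obtain ⟨k, hk⟩ : ∃ k, ¬ Disjoint (q k) t := by
    by_contra! h
    have := iSup_disjoint_iff.2 h
    rw [hq, top_disjoint] at this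
    exact htne this
  choose p hpE hp using fun n => hnext (E n) (q k) hk
  have hinj : Function.Injective p := by
    refine .of_lt_imp_ne fun m n hmn h => (hpE n).2 (h ▸ ?_)
    have := (hpE m).1
    rw [← hE] at this
    exact hmono hmn this
  refine infinite_range_of_injective hinj ((hfin k).subset ?_)
  rintro _ ⟨n, rfl⟩
  have := (hpE n).1
  rw [← hE] at this
  exact ⟨mem_iUnion.2 ⟨n + 1, this⟩, hp n⟩

/-- The dichotomy provides countably many neighbourhoods with intersection `{⊥}`. -/
theorem PIdealDichotomy.exists_isNbhd_seq (hstar : PIdealDichotomy.{u}) (hB : CCC B)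
    (hwd : WeaklyDistributive B) :
    ∃ U : ℕ → Set B, (∀ n, IsNbhd (U n)) ∧ ∀ a, (∀ n, a ∈ U n) → a = ⊥ := by
  -- The factor `ℕ` makes the set infinite even for finite `B`; only the copy `(b, 0)` is used
  -- afterwards.
  rcases hstar (B × ℕ) (nullIdeal B) (fun A hA => (mem_nullIdeal.1 hA).1)
    (isPIdeal_nullIdeal hB hwd) with ⟨Y, hYc, hY⟩ | ⟨T, hT, hfin⟩
  · exact absurd (hB.countable_of_forall_mem_nullIdeal hY) hYc
  refine ⟨fun n => {a | ∀ b ≤ a, b ∈ {b | b = ⊥ ∨ (b, 0) ∉ T n}}, fun n => isNbhd_lowerCore ?_, ?_⟩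
  · by_contra h
    obtain ⟨x, ⟨r, hr, hd⟩, hxV⟩ := exists_isNull_forall_notMem h
    replace hxV : ∀ j, x j ≠ ⊥ ∧ (x j, 0) ∈ T n := fun j =>
      (not_or.1 (hxV j)).imp_right not_not.1
    obtain ⟨q, hqm, hq, hqd⟩ := IsNull.exists_monotone ⟨r, hr, hd⟩
    have hmem : range (fun j => (x j, 0)) ∈ nullIdeal B := by
      refine mem_nullIdeal.2 ⟨countable_range _, q, hqm, hq, fun k => ?_⟩
      obtain ⟨J, hJ⟩ := eventually_atTop.1 (hqd k)
      refine ((finite_Iio J).image fun j => (x j, 0)).subset ?_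
      rintro _ ⟨⟨j, rfl⟩, hj⟩
      refine ⟨j, ?_, rfl⟩
      by_contra hJj
      exact hj (hJ j (not_lt.1 hJj))
    have hrange : (range (fun j => (x j, 0))).Finite := by
      refine (hfin n _ hmem).subset fun p hp => ⟨?_, hp⟩
      obtain ⟨j, rfl⟩ := hp
      exact (hxV j).2
    -- With finite range, `x` takes a nonzero value infinitely often, which a null sequence cannot
    -- do.
    have hfr : ∃ a ≠ ⊥, ∃ᶠ j in atTop, x j = a := by
      have : Finite (range fun j => (x j, 0)) := hrange
      obtain ⟨⟨_, i, rfl⟩, hi⟩ := Finite.exists_infinite_fiber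
        (rangeFactorization fun j : ℕ => (x j, 0))
      refine ⟨x i, (hxV i).1, Nat.frequently_atTop_iff_infinite.2 ?_⟩
      refine (infinite_coe_iff.1 hi).mono fun j hj => ?_
      have : (x j, 0) = (x i, 0) := congrArg Subtype.val hj
      exact congrArg Prod.fst this
    obtain ⟨a, ha, hfa⟩ := hfr
    have : Disjoint (⨆ k, r k) a := iSup_disjoint_iff.2 fun k => by
      obtain ⟨j, hj, hdj⟩ := (hfa.and_eventually (hd k)).exists
      exact hj ▸ hdj
    rw [hr, top_disjoint] at this
    exact ha this
  · intro a ha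
    by_contra hne
    obtain ⟨n, hn⟩ := mem_iUnion.1 (hT ▸ mem_univ (a, 0))
    exact (ha n a le_rfl).elim hne fun h => h hn

/-! ### Separation and chains of neighbourhoods -/

/-- Distinct points are separated by two-fold joins of neighbourhoods. -/
theorem exists_isNbhd_notMem_twoFold (hB : CCC B) (hwd : WeaklyDistributive B) {U : ℕ → Set B}
    (hU : ∀ n, IsNbhd (U n)) (hbot : ∀ a, (∀ n, a ∈ U n) → a = ⊥) {a : B} (ha : a ≠ ⊥) :
    ∃ V, IsNbhd V ∧ a ∉ twoFold V := by
  by_contra! hcon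
  -- Otherwise the `v` with `a \ v ∉ U n` contain a neighbourhood; then `a ≤ u ⊔ v` with `u ∈ U n`
  -- and `v` in it gives `a \ v ≤ u`, a contradiction.
  have hdense : ∀ n, ∃ v : ℕ → B, IsNull v ∧ ∀ j, a \ v j ∈ U n := by
    intro n
    have : ¬ ∀ v : ℕ → B, IsNull v → ∀ᶠ j in atTop, v j ∈ {v | a \ v ∉ U n} := by
      intro h
      obtain ⟨u, hu, v, hv, hle⟩ := hcon _ ((hU n).inter (isNbhd_lowerCore h))
      exact hv.2 v le_rfl ((hU n).lower (sdiff_le_iff.2 (hle.trans_eq (sup_comm u v))) hu.1)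
    obtain ⟨v, hv, hvU⟩ := exists_isNull_forall_notMem this
    exact ⟨v, hv, fun j => not_not.1 (hvU j)⟩
  choose v hv hvU using hdense
  choose q hqm hq hqd using fun n => (hv n).exists_monotone
  have hqU : ∀ n j, a ⊓ q n j ∈ U n := fun n j => by
    obtain ⟨i, hi⟩ := (hqd n j).exists
    refine (hU n).lower ?_ (hvU n i)
    exact le_sdiff.2 ⟨inf_le_left, hi.mono_left inf_le_right⟩
  obtain ⟨r, hr, hrq⟩ := hwd.exists_refinement hB q hqm hq
  have : Disjoint (⨆ k, r k) a := iSup_disjoint_iff.2 fun k => by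
    rw [disjoint_iff, inf_comm]
    refine hbot _ fun n => ?_
    obtain ⟨j, hj⟩ := hrq k n
    exact (hU n).lower (inf_le_inf_left a hj) (hqU n j)
  rw [hr, top_disjoint] at this
  exact ha this

/-- Sequences of neighbourhoods each of which contains the joins of three members of the next. -/
structure IsNbhdChain (W : ℕ → Set B) : Prop where
  isNbhd : ∀ n, IsNbhd (W n)
  sup_mem : ∀ n, ∀ a ∈ W (n + 1), ∀ b ∈ W (n + 1), ∀ c ∈ W (n + 1), a ⊔ b ⊔ c ∈ W n

theorem IsNbhdChain.antitone {W : ℕ → Set B} (hW : IsNbhdChain W) : Antitone W :=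
  antitone_nat_of_succ_le fun n a ha => by
    have hbot := (hW.isNbhd (n + 1)).bot_mem
    simpa using hW.sup_mem n a ha ⊥ hbot ⊥ hbot

theorem isNbhdChain_univ : IsNbhdChain (fun _ => univ : ℕ → Set B) :=
  ⟨fun _ => isNbhd_univ, by simp⟩

/-- Three members of a `twoFold` involve six elements, whence the six-fold joins; returning to
`twoFold` closes the recursion. -/
theorem IsNbhd.exists_isNbhdChain (hB : CCC B) (hwd : WeaklyDistributive B) {U : Set B}
    (hU : IsNbhd U) : ∃ W, IsNbhdChain W ∧ W 0 = twoFold U := by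
  have hstep : ∀ V : {V : Set B // IsNbhd V}, ∃ V' : {V : Set B // IsNbhd V},
      ∀ a ∈ twoFold V'.1, ∀ b ∈ twoFold V'.1, ∀ c ∈ twoFold V'.1, a ⊔ b ⊔ c ∈ twoFold V.1 := by
    rintro ⟨V, hV⟩
    obtain ⟨V', hV', hsup⟩ := hV.exists_forall_sup_mem_twoFold hB hwd 6
    refine ⟨⟨V', hV'⟩, ?_⟩
    rintro a ⟨a₁, ha₁, a₂, ha₂, ha⟩ b ⟨b₁, hb₁, b₂, hb₂, hb⟩ c ⟨c₁, hc₁, c₂, hc₂, hc⟩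
    let f : Fin 6 → B := ![a₁, a₂, b₁, b₂, c₁, c₂]
    have hle : ∀ i, f i ≤ Finset.univ.sup f := fun i => Finset.le_sup (Finset.mem_univ i)
    refine (isNbhd_twoFold hV).lower ?_ (hsup f ?_)
    · exact sup_le (sup_le (ha.trans (sup_le (hle 0) (hle 1)))
        (hb.trans (sup_le (hle 2) (hle 3)))) (hc.trans (sup_le (hle 4) (hle 5)))
    · intro i
      fin_cases i <;> assumption
  choose next hnext using hstep
  refine ⟨fun n => twoFold (next^[n] ⟨U, hU⟩).1,
    ⟨fun n => isNbhd_twoFold (next^[n] ⟨U, hU⟩).2, fun n => ?_⟩, rfl⟩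
  simp only [Function.iterate_succ_apply']
  exact hnext _

/-- The intersection of a chain of neighbourhoods has a largest element. -/
theorem IsNbhdChain.sSup_mem (hB : CCC B) {W : ℕ → Set B} (hW : IsNbhdChain W) (n : ℕ) :
    sSup (⋂ n, W n) ∈ W n := by
  obtain ⟨C, hCW, hC, hsup⟩ := hB.exists_countable_sSup_eq (⋂ n, W n)
  have hbot : ∀ n, ⊥ ∈ W n := fun n => (hW.isNbhd n).bot_mem
  obtain ⟨c, hc⟩ := (hC.insert ⊥).exists_eq_range (insert_nonempty _ _)
  have hcW : ∀ k n, c k ∈ W n := by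
    intro k n
    rcases (hc ▸ mem_range_self k : c k ∈ insert ⊥ C) with h | h
    · exact h ▸ hbot n
    · exact mem_iInter.1 (hCW h) n
  have hps : ∀ k n, partialSups c k ∈ W n := by
    intro k
    induction k with
    | zero => simpa using hcW 0
    | succ k ih =>
      intro n
      rw [partialSups_add_one]
      simpa using hW.sup_mem n _ (ih (n + 1)) _ (hcW (k + 1) (n + 1)) ⊥ (hbot (n + 1))
  have hs : ⨆ k, partialSups c k = sSup (⋂ n, W n) := by
    rw [iSup_partialSups_eq, ← sSup_range, ← hc, sSup_insert, bot_sup_eq, hsup]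
  have hnull : IsNull fun k => sSup (⋂ n, W n) \ partialSups c k := by
    refine isNull_of_antitone
      (fun a b hab => sdiff_le_sdiff_left ((partialSups c).monotone hab)) ?_
    simp only [_root_.sdiff_eq]
    rw [← inf_iInf, ← compl_iSup, hs, inf_compl_eq_bot]
  obtain ⟨k, hk⟩ := ((hW.isNbhd (n + 1)).absorbs _ hnull).exists
  refine (hW.isNbhd n).lower ?_ (hW.sup_mem n _ (hps k (n + 1)) _ hk ⊥ (hbot (n + 1)))
  rw [sup_sdiff_self_right, sup_bot_eq]
  exact le_sup_right

/-- If every nonzero element is left out by some chain of neighbourhoods, then some chain of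
neighbourhoods leaves out all nonzero elements. -/
theorem exists_isNbhdChain_forall_eq_bot (hB : CCC B)
    (h : ∀ a : B, a ≠ ⊥ → ∃ W, IsNbhdChain W ∧ a ∉ W 0) :
    ∃ W : ℕ → Set B, IsNbhdChain W ∧ ∀ a, (∀ n, a ∈ W n) → a = ⊥ := by
  -- Each chain is recorded by the largest element of its intersection. The infimum of these is `⊥`,
  -- and the ccc reduces it to countably many chains, which are then intersected diagonally.
  let X : Set B := {s | ∃ W : ℕ → Set B, IsNbhdChain W ∧ s = sSup (⋂ n, W n)}
  have hX : sInf X = ⊥ := by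
    by_contra hne
    obtain ⟨W, hW, hnot⟩ := h _ hne
    exact hnot ((hW.isNbhd 0).lower (sInf_le ⟨W, hW, rfl⟩) (hW.sSup_mem hB 0))
  obtain ⟨C, hCX, hC, hinf⟩ := hB.exists_countable_sInf_eq X
  obtain ⟨c, hc⟩ := (hC.insert ⊤).exists_eq_range (insert_nonempty _ _)
  have hcX : ∀ i, c i ∈ X := by
    intro i
    rcases (hc ▸ mem_range_self i : c i ∈ insert ⊤ C) with h | h
    · exact ⟨fun _ => univ, isNbhdChain_univ, by simp [h]⟩
    · exact hCX h
  have hcinf : ⨅ i, c i = ⊥ := by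
    rw [← sInf_range, ← hc, sInf_insert, top_inf_eq, hinf, hX]
  choose W hW hcW using hcX
  refine ⟨fun n => ⋂ i ∈ Iic n, W i n,
    ⟨fun n => IsNbhd.biInter (finite_Iic n) fun i _ => (hW i).isNbhd n, ?_⟩, ?_⟩
  · intro n a ha b hb c hc
    simp only [mem_iInter, mem_Iic] at ha hb hc ⊢
    exact fun i hi => (hW i).sup_mem n a (ha i (by omega)) b (hb i (by omega)) c
      (hc i (by omega))
  · intro a ha
    rw [eq_bot_iff, ← hcinf]
    refine le_iInf fun i => ?_
    rw [hcW i]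
    refine le_sSup (mem_iInter.2 fun n => ?_)
    have := ha (max i n)
    simp only [mem_iInter, mem_Iic] at this
    exact (hW i).antitone (le_max_right i n) (this i (le_max_left i n))

/-! ### Metrization and the submeasure -/

open scoped NNReal in
/-- The dyadic gauge of a chain of neighbourhoods. -/
theorem IsNbhdChain.exists_gauge {W : ℕ → Set B} (hW : IsNbhdChain W) :
    ∃ f : B → ℝ≥0, ∀ a, f a ≤ 1 ∧ (∀ n, (1 / 2) ^ n ≤ f a ↔ a ∉ W n) ∧
      (f a ≠ 0 → ∃ n, f a = (1 / 2) ^ n) := by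
  classical
  have hhalf : (1 / 2 : ℝ≥0) < 1 := NNReal.half_lt_self one_ne_zero
  have hanti := pow_right_strictAnti₀ (a := (1 / 2 : ℝ≥0)) (by positivity) hhalf
  refine ⟨fun a => if h : ∃ n, a ∉ W n then (1 / 2) ^ Nat.find h else 0, fun a => ?_⟩
  by_cases h : ∃ n, a ∉ W n
  · simp only [dif_pos h]
    refine ⟨pow_le_one₀ (by positivity) hhalf.le, fun n => ?_, fun _ => ⟨_, rfl⟩⟩
    rw [hanti.le_iff_ge, Nat.find_le_iff]
    exact ⟨fun ⟨m, hmn, hm⟩ hn => hm (hW.antitone hmn hn), fun hn => ⟨n, le_rfl, hn⟩⟩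
  · simp only [dif_neg h]
    push Not at h
    exact ⟨zero_le_one, fun n => by simp [h n], by simp⟩

/-- A chain of neighbourhoods with intersection `{⊥}` yields a strictly positive Maharam
submeasure. -/
theorem IsNbhdChain.exists_isMaharamSubmeasure {W : ℕ → Set B} (hW : IsNbhdChain W)
    (hbot : ∀ a, (∀ n, a ∈ W n) → a = ⊥) :
    ∃ μ : B → ℝ, IsMaharamSubmeasure μ ∧ IsStrictlyPositive μ := by
  obtain ⟨f, hf⟩ := hW.exists_gauge
  have hf1 := fun a => (hf a).1
  have hfW := fun a => (hf a).2.1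
  have hfpow := fun a => (hf a).2.2
  have hmono : Monotone f := by
    intro a b hab
    by_cases h0 : f a = 0
    · rw [h0]; exact zero_le
    obtain ⟨n, hn⟩ := hfpow a h0
    rw [hn, hfW]
    exact fun hb => (hfW a n).1 hn.ge ((hW.isNbhd n).lower hab hb)
  have hf_bot : f ⊥ = 0 := by
    by_contra h0
    obtain ⟨n, hn⟩ := hfpow _ h0
    exact (hfW _ n).1 hn.ge (hW.isNbhd n).bot_mem
  have hf_eq : ∀ a, f a = 0 → a = ⊥ := by
    refine fun a ha => hbot a fun n => ?_
    by_contra hn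
    rw [← hfW, ha] at hn
    exact absurd hn (not_le.2 (by positivity))
  have hsup : ∀ a b c, f (a ⊔ b ⊔ c) ≤ 2 * max (f a) (max (f b) (f c)) := by
    intro a b c
    by_cases h0 : f (a ⊔ b ⊔ c) = 0
    · rw [h0]; exact zero_le
    obtain ⟨n, hn⟩ := hfpow _ h0
    rw [hn, ← div_le_iff₀' zero_lt_two, ← mul_one_div (_ ^ _), ← pow_succ]
    simp only [le_max_iff, hfW]
    by_contra! h
    exact (hfW _ n).1 hn.ge (hW.sup_mem n a h.1 b h.2.1 c h.2.2)
  -- Frink's chain construction needs the weak triangle inequality for three steps, hence the triple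
  -- joins in `IsNbhdChain`; it gives a metric between half the gauge and the gauge.
  let I : PseudoMetricSpace B := PseudoMetricSpace.ofPreNNDist (fun x y => f (symmDiff x y))
    (fun x => by rw [symmDiff_self, hf_bot]) (fun x y => by rw [symmDiff_comm])
  have hdist_le : ∀ x y : B, dist x y ≤ f (symmDiff x y) :=
    PseudoMetricSpace.dist_ofPreNNDist_le _ _ _
  have hle_dist : ∀ x y : B, f (symmDiff x y) ≤ 2 * dist x y := by
    refine PseudoMetricSpace.le_two_mul_dist_ofPreNNDist _ _ _ fun x₁ x₂ x₃ x₄ => ?_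
    refine (hmono ?_).trans (hsup _ _ _)
    exact (symmDiff_triangle x₁ x₃ x₄).trans (sup_le_sup_right (symmDiff_triangle x₁ x₂ x₃) _)
  have hbound : ∀ a x b, b ≤ a → dist x (x ⊔ b) ≤ f a := by
    intro a x b hba
    refine (hdist_le _ _).trans (NNReal.coe_le_coe.2 (hmono ?_))
    rw [symmDiff_of_le le_sup_left]
    exact (sdiff_le_iff.2 le_rfl).trans hba
  have hbdd : ∀ a : B, BddAbove (range fun p : B × Iic a => dist p.1 (p.1 ⊔ p.2.1)) := by
    rintro a
    refine ⟨f a, ?_⟩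
    rintro _ ⟨⟨x, b, hb⟩, rfl⟩
    exact hbound a x b hb
  -- The supremum over `b ≤ a` forces monotonicity; the one over base points `x` gives
  -- subadditivity, by moving from `x` to `x ⊔ c` in two steps. The bounds `f a / 2 ≤ μ a ≤ f a`
  -- survive.
  let μ : B → ℝ := fun a => ⨆ p : B × Iic a, dist p.1 (p.1 ⊔ p.2.1)
  have hdist_le_μ : ∀ a x b, b ≤ a → dist x (x ⊔ b) ≤ μ a := fun a x b hba =>
    le_ciSup (hbdd a) (x, ⟨b, hba⟩)
  have hμ_le : ∀ a r, (∀ x b, b ≤ a → dist x (x ⊔ b) ≤ r) → μ a ≤ r := fun a r h =>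
    have : Nonempty (B × Iic a) := ⟨(⊥, ⟨a, le_rfl⟩)⟩
    ciSup_le fun p => h p.1 p.2.1 p.2.2
  have hμf : ∀ a, μ a ≤ f a := fun a => hμ_le a _ (hbound a)
  have hμ_nonneg : ∀ a, 0 ≤ μ a := fun a => dist_nonneg.trans (hdist_le_μ a ⊥ a le_rfl)
  refine ⟨μ, ⟨⟨hμ_nonneg, ?_, ?_, ?_⟩, ?_⟩, ?_⟩
  · exact le_antisymm ((hμf ⊥).trans (by simp [hf_bot])) (hμ_nonneg ⊥)
  · exact fun a b hab => hμ_le a _ fun x c hc => hdist_le_μ b x c (hc.trans hab)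
  · refine fun a b => hμ_le _ _ fun x c hc => ?_
    have hc' : x ⊔ c = x ⊔ c ⊓ a ⊔ c ⊓ b := by
      rw [sup_assoc, ← inf_sup_left, inf_eq_left.2 hc]
    rw [hc']
    exact (dist_triangle _ (x ⊔ c ⊓ a) _).trans
      (add_le_add (hdist_le_μ a _ _ inf_le_right) (hdist_le_μ b _ _ inf_le_right))
  · intro a ha hinf
    refine squeeze_zero (fun n => hμ_nonneg _) (fun n => hμf _) ?_
    rw [Metric.tendsto_atTop']
    intro ε hε
    obtain ⟨m, hm⟩ := exists_pow_lt_of_lt_one hε (one_half_lt_one (α := ℝ))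
    obtain ⟨N, hN⟩ := eventually_atTop.1
      ((hW.isNbhd m).absorbs a (isNull_of_antitone ha hinf))
    refine ⟨N, fun n hn => ?_⟩
    have hlt : f (a n) < (1 / 2) ^ m := not_le.1 fun h => (hfW _ m).1 h (hN n hn.le)
    have hlt' : (f (a n) : ℝ) < (1 / 2) ^ m := by exact_mod_cast hlt
    simpa using hlt'.trans hm
  · intro a ha
    refine hf_eq a (le_antisymm ?_ zero_le)
    have h1 := hle_dist ⊥ (⊥ ⊔ a)
    have h2 := hdist_le_μ a ⊥ a le_rfl
    rw [bot_sup_eq, bot_symmDiff] at h1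
    rw [bot_sup_eq] at h2
    exact NNReal.coe_le_coe.1 (by rw [NNReal.coe_zero]; linarith)

end BooleanSubmeasure

theorem mainTheorem3 (hstar : BooleanSubmeasure.PIdealDichotomy.{u})
    (B : Type u) [CompleteBooleanAlgebra B]
    (hccc : BooleanSubmeasure.CCC B)
    (hwd : BooleanSubmeasure.WeaklyDistributive B) :
    ∃ μ : B → ℝ, BooleanSubmeasure.IsMaharamSubmeasure μ ∧
      BooleanSubmeasure.IsStrictlyPositive μ := by
  obtain ⟨U, hU, hbot⟩ := hstar.exists_isNbhd_seq hccc hwd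
  obtain ⟨W, hW, hWbot⟩ := BooleanSubmeasure.exists_isNbhdChain_forall_eq_bot hccc fun a ha => by
    obtain ⟨V, hV, haV⟩ :=
      BooleanSubmeasure.exists_isNbhd_notMem_twoFold hccc hwd hU hbot ha
    obtain ⟨W, hW, hW0⟩ := hV.exists_isNbhdChain hccc hwd
    exact ⟨W, hW, hW0 ▸ haV⟩
  exact hW.exists_isMaharamSubmeasure hWbot
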